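/- Let $a,n,c,t\ge 1$ be integers and $\mathcal X\subseteq\mathbb R^a$. A problem instance is a dataset $D=((X_i,y_i))_{i=1}^n\in(\mathcal X\times[c])^n$. Let $\mathcal F$ be a finite class of (measurable) Boolean functions on $\mathcal X$. A decision tree is a binary tree whose internal nodes are labeled by functions in $\mathcal F$ (the value at a point decides which child the point is sent to) and whose leaves are labeled by classes in $[c]$; $T(x)$ is the class of the leaf reached by $x$. The size of a tree is its number of internal nodes, and $L(T,D)=\frac1n\sum_{i=1}^n\mathbf I[T(X_i)\ne y_i]$. Let $D\mapsto T_D$ be a (measurable) tree-growing rule that assigns to each instance $D$ an unpruned decision tree $T_D$ of size at most $t$. For parameters $c_1,c_2\in\mathbb R_{\ge0}$, an internal node $h$ of $T=T_D$ passes the pessimistic pruning test if $$e_l\le e_h+c_1\sqrt{\frac{t_h\log a+c_2}{n_h}},$$ where $n_h$ is the number of examples of $D$ that reach $h$ in $T$, $e_h$ is the fraction of these that are misclassified by the sub-tree of $T$ rooted at $h$, $t_h$ is the size of that sub-tree, and $e_l$ is the fraction of these that are misclassified if $h$ is replaced by a leaf labeled by a most common class among them. (Nodes with $n_h=0$, which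 do not affect the loss, count as passing.) The pruned tree $T_D^{c_1,c_2}$ is obtained from $T_D$ by replacing by such leaves the nodes that pass the test, together with everything below them. Given instances $D_1,\dots,D_N$, empirical risk minimization (ERM) outputs $\hat c_1,\hat c_2\ge0$ that minimize $\sum_{i=1}^N L(T_{D_i}^{c_1,c_2},D_i)$ over $c_1,c_2\ge 0$. There is an absolute constant $C>0$ such that the following holds for all $a,n,c,t,\mathcal X,\mathcal F$ and $D\mapsto T_D$ as above. For all $\epsilon,\delta>0$, every probability distribution $\mathcal D$ over problem instances with $n$ examples, and every integer $N\ge0$ with $$N\ge \frac{C}{\epsilon^2}\Big(\log t+\log\frac1\delta\Big),$$ a minimizer $(\hat c_1,\hat c_2)$ exists for every sample of $N$ instances, and with probability at least $1-\delta$ over independent $D_1,\dots,D_N\sim\mathcal D$, every choice of the ERM parameters $(\hat c_1,\hat c_2)$ is $\epsilon$-optimal: $$\mathbb E_{D\sim\mathcal D}\,L(T_D^{\hat c_1,\hat c_2},D)\le \inf_{c_1,c_2\ge0}\mathbb E_{D\sim\mathcal D}\,L(T_D^{c_1,c_2},D)+\epsilon .$$ -/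

import Mathlib

open MeasureTheory

/-- A labeled dataset of `n` examples over the domain `𝒳`, with `c` classes. -/
abbrev Dataset (𝒳 : Type*) (n c : ℕ) : Type _ := Fin n → 𝒳 × Fin c

/-- Binary decision trees: leaves carry a class, internal nodes carry a Boolean node function
(value `false`: go to the left child, value `true`: go to the right child). -/
inductive DTree (𝒳 : Type*) (c : ℕ) : Type _
  | leaf (label : Fin c) : DTree 𝒳 c
  | node (f : 𝒳 → Bool) (left right : DTree 𝒳 c) : DTree 𝒳 c

namespace DTree

variable {𝒳 : Type*} {n c : ℕ}

/-- The class that the tree assigns to a point. -/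
def predict : DTree 𝒳 c → 𝒳 → Fin c
  | leaf k, _ => k
  | node f l r, x => if f x then r.predict x else l.predict x

/-- The size of a tree: its number of internal nodes. -/
def size : DTree 𝒳 c → ℕ
  | leaf _ => 0
  | node _ l r => l.size + r.size + 1

/-- All internal nodes are labeled by functions of the node function class `F`. -/
def NodesIn (F : Set (𝒳 → Bool)) : DTree 𝒳 c → Prop
  | leaf _ => True
  | node f l r => f ∈ F ∧ l.NodesIn F ∧ r.NodesIn F

/-- The 0-1 loss `L(T, D)`: the fraction of examples of `D` that `T` misclassifies. -/
noncomputable def loss (T : DTree 𝒳 c) (D : Dataset 𝒳 n c) : ℝ :=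
  (1 / (n : ℝ)) * ∑ i, if T.predict (D i).1 ≠ (D i).2 then (1 : ℝ) else 0

/-- The fraction of the examples of `D` with index in `S` that `T` misclassifies. -/
noncomputable def errorOn (D : Dataset 𝒳 n c) (S : Finset (Fin n)) (T : DTree 𝒳 c) : ℝ :=
  ((S.filter fun i => T.predict (D i).1 ≠ (D i).2).card : ℝ) / (S.card : ℝ)

end DTree

section Pruning

variable {𝒳 : Type*} {n c : ℕ}

/-- The number of examples with index in `S` whose class is `k`. -/
def labelCount (D : Dataset 𝒳 n c) (S : Finset (Fin n)) (k : Fin c) : ℕ :=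
  (S.filter fun i => (D i).2 = k).card

theorem exists_mostCommon [NeZero c] (D : Dataset 𝒳 n c) (S : Finset (Fin n)) :
    ∃ k : Fin c, ∀ j : Fin c, labelCount D S j ≤ labelCount D S k :=
  Finite.exists_max (labelCount D S)

/-- A most common class among the examples with index in `S`. (No error fraction on `D` depends
on how ties are broken.) -/
noncomputable def majorityLabel [NeZero c] (D : Dataset 𝒳 n c) (S : Finset (Fin n)) : Fin c :=
  Classical.choose (exists_mostCommon D S)

/-- The pessimistic pruning test `e_l ≤ e_h + c₁ √((t_h log a + c₂) / n_h)` for an internal node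
`h`, where `T` is the sub-tree rooted at `h` and `S` is the set of (indices of) examples
that reach `h`. -/
def PessimisticTest [NeZero c] (a : ℕ) (c₁ c₂ : ℝ) (D : Dataset 𝒳 n c) (S : Finset (Fin n))
    (T : DTree 𝒳 c) : Prop :=
  DTree.errorOn D S (DTree.leaf (majorityLabel D S)) ≤
    DTree.errorOn D S T + c₁ * √(((T.size : ℝ) * Real.log (a : ℝ) + c₂) / (S.card : ℝ))

open Classical in
/-- Pessimistic pruning of the branch `T` reached by the examples with index in `S`: every internal
node of `T` that passes the test is replaced, together with everything below it, by a leaf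
with the majority label. The test at a node `h` is that of the sub-tree of the unpruned tree. -/
noncomputable def pruneBranch [NeZero c] (a : ℕ) (c₁ c₂ : ℝ) (D : Dataset 𝒳 n c) :
    Finset (Fin n) → DTree 𝒳 c → DTree 𝒳 c
  | _, DTree.leaf k => DTree.leaf k
  | S, DTree.node f l r =>
      if PessimisticTest a c₁ c₂ D S (DTree.node f l r) then DTree.leaf (majorityLabel D S)
      else DTree.node f
        (pruneBranch a c₁ c₂ D (S.filter fun i => f (D i).1 = false) l)
        (pruneBranch a c₁ c₂ D (S.filter fun i => f (D i).1 = true) r)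

/-- The loss on the problem instance `D` of the tree obtained by pessimistic pruning, with
parameters `c₁, c₂`, of the unpruned tree `grow D`. -/
noncomputable def prunedLoss [NeZero c] (a : ℕ) (grow : Dataset 𝒳 n c → DTree 𝒳 c)
    (c₁ c₂ : ℝ) (D : Dataset 𝒳 n c) : ℝ :=
  (pruneBranch a c₁ c₂ D Finset.univ (grow D)).loss D

/-- `(c₁, c₂)` is an output of empirical risk minimization over `[0,∞)²` on the sample
`D₁, …, D_N` of problem instances. -/
def IsERM [NeZero c] (a : ℕ) (grow : Dataset 𝒳 n c → DTree 𝒳 c) {N : ℕ}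
    (Ds : Fin N → Dataset 𝒳 n c) (c₁ c₂ : ℝ) : Prop :=
  0 ≤ c₁ ∧ 0 ≤ c₂ ∧ ∀ b₁ b₂ : ℝ, 0 ≤ b₁ → 0 ≤ b₂ →
    ∑ i, prunedLoss a grow c₁ c₂ (Ds i) ≤ ∑ i, prunedLoss a grow b₁ b₂ (Ds i)

/-- The expected loss of `(c₁, c₂)` over `μ` is at most `ε` larger than that of every other
choice of parameters in `[0,∞)²`. -/
def IsEpsOptimal [NeZero c] [MeasurableSpace 𝒳] (a : ℕ) (grow : Dataset 𝒳 n c → DTree 𝒳 c)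
    (μ : Measure (Dataset 𝒳 n c)) (ε c₁ c₂ : ℝ) : Prop :=
  ∀ b₁ b₂ : ℝ, 0 ≤ b₁ → 0 ≤ b₂ →
    ∫ D, prunedLoss a grow c₁ c₂ D ∂μ ≤ (∫ D, prunedLoss a grow b₁ b₂ D ∂μ) + ε

end Pruning

/-! The problem is realizable. With `c₁ = 0` a node is collapsed exactly when this does not increase
the error on its examples, so on every single instance the parameters `(0, 0)` attain the smallest
training loss among all `(c₁, c₂)` (`prunedLoss_zero_le`). Hence `(0, 0)` is always an ERM output,
and any other ERM output must tie with it on every sampled instance: the sample misses its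
`worseSet` (`IsERM.notMem_worseSet`). Losses lie in `[0, 1]`, so the excess expected loss is at most
the measure of that set. It remains to show that the sample is likely to hit every `worseSet` of
measure above `ε`, which is an ε-net statement.

In the coordinates `u = c₁²`, `v = c₁² c₂` each pruning test is a half-plane
(`pessimisticTest_iff`). On `2N` instances there are at most `2Nt` tests, and an arrangement of `M`
half-planes has at most `(M + 1)³` cells (`ncard_range_cell_le`), so the sets `worseSet` cut out at
most `(2Nt + 1)³` patterns. Double sampling (`measure_exists_missed_mul_le`) bounds the failure
probability by `(2Nt + 1)³ / (1 + ε)^N`. The factor `1/ε²` in the sample size leaves room for the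
`log N` term as soon as `log t ≥ log 2`. For `t = 1` this room is absent, but the sets form a chain
and `(1 - ε)^N` suffices. -/

/-! ### Epsilon-nets: double sampling, and the case of a chain -/

section DoubleSample

open ProbabilityTheory Finset
open scoped ENNReal

/-- The weight of a pair of membership indicators: `0` if the first holds, otherwise `2` or `1`
according to the second. -/
def pairWeight (b : Bool × Bool) : ℝ≥0∞ := if b.1 then 0 else if b.2 then 2 else 1

theorem pairWeight_add_swap_le (b : Bool × Bool) : pairWeight b + pairWeight b.swap ≤ 2 := by
  rcases b with ⟨_ | _, _ | _⟩ <;> simp [pairWeight, one_add_one_eq_two]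

/-- Exchange the entries of a pair if `b` holds. -/
def condSwap {α : Type*} (b : Bool) (p : α × α) : α × α := if b then p.swap else p

theorem measurePreserving_condSwap {Ω : Type*} [MeasurableSpace Ω] (μ : Measure Ω) [SFinite μ]
    (b : Bool) : MeasurePreserving (condSwap b) (μ.prod μ) (μ.prod μ) := by
  cases b
  · exact MeasurePreserving.id _
  · exact Measure.measurePreserving_swap

/-- The sum over swaps factors over the coordinates, and each factor is `pairWeight b + pairWeight
b.swap ≤ 2`. So a fixed pattern has average weight at most `1` under random swaps. -/
theorem sum_prod_pairWeight_condSwap_le {N : ℕ} (p : Fin N → Bool × Bool) :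
    ∑ σ : Fin N → Bool, ∏ k, pairWeight (condSwap (σ k) (p k)) ≤ 2 ^ N := by
  have h := Finset.prod_univ_sum (fun _ : Fin N => (Finset.univ : Finset Bool))
    (fun k b => pairWeight (condSwap b (p k)))
  rw [Fintype.piFinset_univ] at h
  rw [← h]
  calc _ ≤ ∏ _k : Fin N, (2 : ℝ≥0∞) := by
        refine Finset.prod_le_prod' fun k _ => ?_
        simpa [condSwap, add_comm] using pairWeight_add_swap_le (p k)
    _ = _ := by simp

open Classical in
/-- The membership pattern of a sequence of pairs with respect to a set. -/
noncomputable def pairPattern {Ω : Type*} {N : ℕ} (h : Set Ω) (z : Fin N → Ω × Ω) :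
    Fin N → Bool × Bool :=
  fun k => (decide ((z k).1 ∈ h), decide ((z k).2 ∈ h))

theorem lintegral_pi_prod_eq {Ω : Type*} [MeasurableSpace Ω] (μ : Measure Ω)
    [IsProbabilityMeasure μ] {N : ℕ} (g : Ω → ℝ≥0∞) (hg : Measurable g) :
    ∫⁻ s, ∏ k, g (s k) ∂(Measure.pi fun _ : Fin N => μ) = (∫⁻ x, g x ∂μ) ^ N := by
  have hind : iIndepFun (fun (k : Fin N) (s : Fin N → Ω) => g (s k))
      (Measure.pi fun _ : Fin N => μ) := iIndepFun_pi fun _ => hg.aemeasurable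
  have h := lintegral_prod_eq_prod_lintegral_of_indepFun Finset.univ
    (fun (k : Fin N) (s : Fin N → Ω) => g (s k)) hind (fun k => hg.comp (measurable_pi_apply k))
  rw [h]
  have : ∀ k : Fin N, ∫⁻ s, g (s k) ∂(Measure.pi fun _ : Fin N => μ) = ∫⁻ x, g x ∂μ := fun k =>
    (measurePreserving_eval (fun _ : Fin N => μ) k).lintegral_comp hg
  simp [this]

open Classical in
/-- **ε-nets by double sampling**: if the family `h` has at most `G` membership patterns on any
`2N` points, then a sample of size `N` misses a set of the family of measure more than `ε` with
probability at most `G / (1 + ε) ^ N`. -/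
theorem measure_exists_missed_mul_le {Ω ι : Type*} [MeasurableSpace Ω] [Finite ι]
    (μ : Measure Ω) [IsProbabilityMeasure μ] (h : ι → Set Ω) (hm : ∀ i, MeasurableSet (h i))
    {N G : ℕ} (hG : ∀ z : Fin N → Ω × Ω, (Set.range fun i => pairPattern (h i) z).ncard ≤ G)
    (ε : ℝ≥0∞) :
    (Measure.pi fun _ : Fin N => μ) {s | ∃ i, ε < μ (h i) ∧ ∀ k, s k ∉ h i} * (1 + ε) ^ N ≤ G := by
  set P := Measure.pi fun _ : Fin N => μ with hP
  set Q := Measure.pi fun _ : Fin N => μ.prod μ with hQ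
  set A : Set (Fin N → Ω) := {s | ∃ i, ε < μ (h i) ∧ ∀ k, s k ∉ h i} with hA
  have hAm : MeasurableSet A := by
    have : A = ⋃ i, {s : Fin N → Ω | ε < μ (h i) ∧ ∀ k, s k ∉ h i} := by
      ext s; simp [hA]
    rw [this]
    refine MeasurableSet.iUnion fun i => ?_
    refine (MeasurableSet.const _).inter ?_
    have : {s : Fin N → Ω | ∀ k, s k ∉ h i} = ⋂ k, (fun s : Fin N → Ω => s k) ⁻¹' (h i)ᶜ := by
      ext s; simp
    change MeasurableSet {s : Fin N → Ω | ∀ k, s k ∉ h i}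
    exact this ▸ MeasurableSet.iInter fun k => (measurable_pi_apply k) (hm i).compl
  set w : ι → (Fin N → Ω × Ω) → ℝ≥0∞ := fun i z => ∏ k, pairWeight (pairPattern (h i) z k) with hw
  have hwm : ∀ i, Measurable (w i) := by
    intro i
    refine Finset.measurable_fun_prod _ fun k _ => ?_
    refine (measurable_of_countable pairWeight).comp ?_
    have hd : Measurable fun x => decide (x ∈ h i) :=
      measurable_to_bool (by simpa [Set.preimage] using hm i)
    exact (hd.comp (measurable_fst.comp (measurable_pi_apply k))).prodMk
      (hd.comp (measurable_snd.comp (measurable_pi_apply k)))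
  set W : (Fin N → Ω × Ω) → ℝ≥0∞ := fun z => ⨆ i, w i z with hW
  have hWm : Measurable W := Measurable.iSup hwm
  -- lower bound
  have hlow : P A * (1 + ε) ^ N ≤ ∫⁻ z, W z ∂Q := by
    -- The `N` pairs are regrouped as a sample `s` and an independent ghost sample `s'`. If `s`
    -- misses `h i`, the weight is the product of the factors `1 + 1_{h i}(s' k)`, whose mean over
    -- `s'` is `(1 + μ (h i)) ^ N`.
    have hmp := (measurePreserving_arrowProdEquivProdArrow Ω Ω (Fin N) (fun _ => μ)
      (fun _ => μ)).symm
    rw [← hmp.lintegral_comp hWm, lintegral_prod (fun z => W _) (hWm.comp hmp.measurable).aemeasurable,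
      mul_comm, ← lintegral_indicator_const hAm]
    refine lintegral_mono fun s => ?_
    by_cases hs : s ∈ A
    · rw [Set.indicator_of_mem hs]
      obtain ⟨i, hi, hmiss⟩ := hs
      calc (1 + ε) ^ N ≤ (1 + μ (h i)) ^ N := by gcongr
        _ = (∫⁻ x, (1 + (h i).indicator 1 x) ∂μ) ^ N := by
          rw [lintegral_add_left measurable_const, lintegral_indicator_one (hm i)]; simp
        _ = ∫⁻ s', ∏ k, (1 + (h i).indicator 1 (s' k)) ∂P :=
          (lintegral_pi_prod_eq μ _ (measurable_const.add (measurable_one.indicator (hm i)))).symm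
        _ ≤ _ := by
          refine lintegral_mono fun s' => ?_
          refine le_trans (le_of_eq ?_) (le_iSup _ i)
          refine Finset.prod_congr rfl fun k _ => ?_
          have h1 : s k ∉ h i := hmiss k
          by_cases h2 : s' k ∈ h i <;>
            simp [pairWeight, pairPattern, MeasurableEquiv.arrowProdEquivProdArrow,
              Equiv.arrowProdEquivProdArrow, h1, h2, one_add_one_eq_two]
    · simp [Set.indicator_of_notMem hs]
  -- upper bound
  have hswap : ∀ σ : Fin N → Bool,
      ∫⁻ z, W (fun k => condSwap (σ k) (z k)) ∂Q = ∫⁻ z, W z ∂Q := fun σ =>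
    (measurePreserving_pi (fun _ : Fin N => μ.prod μ) (fun _ => μ.prod μ)
      (fun k => measurePreserving_condSwap μ (σ k))).lintegral_comp hWm
  -- For fixed `z` the weight depends on `i` only through its pattern, so the supremum over the
  -- family is at most a sum over at most `G` patterns.
  have hpt : ∀ z : Fin N → Ω × Ω, ∑ σ : Fin N → Bool, W (fun k => condSwap (σ k) (z k)) ≤ G * 2 ^ N := by
    intro z
    set R := (Set.range fun i => pairPattern (h i) z).toFinset with hR
    have hRc : R.card ≤ G := by
      have := hG z
      rwa [Set.ncard_eq_toFinset_card'] at this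
    calc _ ≤ ∑ σ : Fin N → Bool, ∑ p ∈ R, ∏ k, pairWeight (condSwap (σ k) (p k)) := by
          refine Finset.sum_le_sum fun σ _ => iSup_le fun i => ?_
          have hmem : pairPattern (h i) z ∈ R := by simp [hR]
          refine le_trans (le_of_eq ?_) (Finset.single_le_sum (fun _ _ => zero_le) hmem)
          refine Finset.prod_congr rfl fun k _ => ?_
          cases hσ : σ k <;> simp [pairPattern, condSwap, hσ]
      _ = ∑ p ∈ R, ∑ σ : Fin N → Bool, ∏ k, pairWeight (condSwap (σ k) (p k)) :=
          Finset.sum_comm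
      _ ≤ ∑ _p ∈ R, 2 ^ N := Finset.sum_le_sum fun p _ => sum_prod_pairWeight_condSwap_le p
      _ ≤ G * 2 ^ N := by
          rw [Finset.sum_const, nsmul_eq_mul]; gcongr
  have hup : ∫⁻ z, W z ∂Q ≤ G := by
    have h2 : (2 : ℝ≥0∞) ^ N * ∫⁻ z, W z ∂Q ≤ 2 ^ N * G := by
      calc _ = ∑ σ : Fin N → Bool, ∫⁻ z, W (fun k => condSwap (σ k) (z k)) ∂Q := by
            simp [hswap]
        _ = ∫⁻ z, ∑ σ : Fin N → Bool, W (fun k => condSwap (σ k) (z k)) ∂Q := by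
            rw [lintegral_finsetSum]
            intro σ _
            exact hWm.comp (measurePreserving_pi (fun _ : Fin N => μ.prod μ)
              (fun _ => μ.prod μ) (fun k => measurePreserving_condSwap μ (σ k))).measurable
        _ ≤ ∫⁻ _z, G * 2 ^ N ∂Q := lintegral_mono hpt
        _ = _ := by simp [mul_comm]
    exact (ENNReal.mul_le_mul_iff_right (by simp) (by simp)).1 h2
  exact hlow.trans hup

/-- For a family of sets that is totally ordered by inclusion, a sample of size `N` misses a set
of the family of measure more than `ε` with probability at most `(1 - ε) ^ N`. -/
theorem measure_exists_missed_le_of_chain {Ω ι : Type*} [MeasurableSpace Ω] [Finite ι]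
    (μ : Measure Ω) [IsProbabilityMeasure μ] (h : ι → Set Ω) (hm : ∀ i, MeasurableSet (h i))
    (hc : ∀ i j, h i ⊆ h j ∨ h j ⊆ h i) (N : ℕ) (ε : ℝ≥0∞) :
    (Measure.pi fun _ : Fin N => μ) {s | ∃ i, ε < μ (h i) ∧ ∀ k, s k ∉ h i} ≤ (1 - ε) ^ N := by
  by_cases hne : ∃ i, ε < μ (h i)
  -- By the chain condition, a large set of least measure is contained, up to a null set, in every
  -- large set. Its part `B` inside all of them has the same measure, and a sample that misses any
  -- large set misses `B`.
  · obtain ⟨i, hi, hmin⟩ := Set.exists_min_image {i | ε < μ (h i)} (fun i => μ (h i))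
      (Set.toFinite _) hne
    have hsub : ∀ j, ε < μ (h j) → μ (h i \ h j) = 0 := by
      intro j hj
      rcases hc i j with hij | hji
      · simp [Set.sdiff_eq_empty.2 hij]
      · rw [measure_sdiff hji (hm j).nullMeasurableSet (measure_ne_top _ _)]
        exact tsub_eq_zero_of_le (hmin j hj)
    have hsub' : μ (⋃ j ∈ {j | ε < μ (h j)}, h i \ h j) = 0 :=
      (measure_biUnion_null_iff (Set.to_countable _)).2 hsub
    set B := h i \ ⋃ j ∈ {j | ε < μ (h j)}, h i \ h j with hB
    have hBm : μ B = μ (h i) := measure_sdiff_null hsub'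
    have hBmeas : MeasurableSet B :=
      (hm i).diff (MeasurableSet.biUnion (Set.to_countable _) fun j _ => (hm i).diff (hm j))
    calc _ ≤ (Measure.pi fun _ : Fin N => μ) (Set.univ.pi fun _ => Bᶜ) := by
          refine measure_mono ?_
          rintro s ⟨j, hj, hs⟩ k - hk
          refine hk.2 ?_
          exact Set.mem_biUnion hj ⟨hk.1, hs k⟩
      _ = (1 - μ (h i)) ^ N := by
          rw [Measure.pi_pi]; simp [prob_compl_eq_one_sub hBmeas, hBm]
      _ ≤ _ := pow_le_pow_left' (tsub_le_tsub_left (le_of_lt hi) 1) N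
  · simp only [not_exists] at hne
    simp [hne]

end DoubleSample

/-! ### Counting the cells of an arrangement of half-planes -/

section Cells

open Finset

/-- A monotone family of subsets of a finite set has at most one member of each cardinality. -/
theorem eq_of_card_eq_of_total {α : Type*} {A B : Finset α} (h : A ⊆ B ∨ B ⊆ A)
    (hc : A.card = B.card) : A = B :=
  h.elim (fun h => eq_of_subset_of_card_le h hc.ge) fun h =>
    (eq_of_subset_of_card_le h hc.le).symm

open Classical in
/-- The members `(τ, r)` of `P` with `r ≤ u τ + v`. -/
noncomputable def cell (P : Finset (ℝ × ℝ)) (x : ℝ × ℝ) : Finset (ℝ × ℝ) :=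
  P.filter fun p => p.2 ≤ x.1 * p.1 + x.2

open Classical in
/-- The cell of slope parameter `u` whose offset is that of the line through `j`, to the right
of `j`. -/
noncomputable def cellRight (P : Finset (ℝ × ℝ)) (j : ℝ × ℝ) (u : ℝ) : Finset (ℝ × ℝ) :=
  P.filter fun p => j.1 ≤ p.1 ∧ p.2 - j.2 ≤ u * (p.1 - j.1)

open Classical in
/-- The cell of slope parameter `u` whose offset is that of the line through `j`, to the left
of `j`. -/
noncomputable def cellLeft (P : Finset (ℝ × ℝ)) (j : ℝ × ℝ) (u : ℝ) : Finset (ℝ × ℝ) :=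
  P.filter fun p => p.1 < j.1 ∧ p.2 - j.2 ≤ u * (p.1 - j.1)

theorem cellRight_total (P : Finset (ℝ × ℝ)) (j : ℝ × ℝ) (u u' : ℝ) :
    cellRight P j u ⊆ cellRight P j u' ∨ cellRight P j u' ⊆ cellRight P j u := by
  rcases le_total u u' with h | h
  · left; exact monotone_filter_right _ fun p _ hp => ⟨hp.1, by nlinarith [hp.1, hp.2]⟩
  · right; exact monotone_filter_right _ fun p _ hp => ⟨hp.1, by nlinarith [hp.1, hp.2]⟩

theorem cellLeft_total (P : Finset (ℝ × ℝ)) (j : ℝ × ℝ) (u u' : ℝ) :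
    cellLeft P j u ⊆ cellLeft P j u' ∨ cellLeft P j u' ⊆ cellLeft P j u := by
  rcases le_total u u' with h | h
  · right; exact monotone_filter_right _ fun p _ hp => ⟨hp.1, by nlinarith [hp.1, hp.2]⟩
  · left; exact monotone_filter_right _ fun p _ hp => ⟨hp.1, by nlinarith [hp.1, hp.2]⟩

/-- Lowering the offset until the line meets the last point `j` of the cell leaves the cell
unchanged. The cell is then described by `j` and the slope alone. -/
theorem exists_cell_eq_union (P : Finset (ℝ × ℝ)) (x : ℝ × ℝ) (hx : (cell P x).Nonempty) :
    ∃ j ∈ P, ∀ p, p ∈ cell P x ↔ p ∈ cellRight P j x.1 ∨ p ∈ cellLeft P j x.1 := by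
  obtain ⟨j, hj, hmax⟩ := exists_max_image (cell P x) (fun p => p.2 - x.1 * p.1) hx
  simp only [cell, mem_filter] at hj hmax
  refine ⟨j, hj.1, fun p => ?_⟩
  simp only [cell, cellRight, cellLeft, mem_filter]
  constructor
  · rintro ⟨hp, hpx⟩
    have := hmax p ⟨hp, hpx⟩
    rcases le_or_gt j.1 p.1 with h | h
    · exact Or.inl ⟨hp, h, by linarith⟩
    · exact Or.inr ⟨hp, h, by linarith⟩
  · rintro (⟨hp, -, h⟩ | ⟨hp, -, h⟩) <;> exact ⟨hp, by linarith [hj.2]⟩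

/-- The number of cells of an arrangement of half-planes is polynomial in their number. -/
theorem ncard_range_cell_le (P : Finset (ℝ × ℝ)) {M : ℕ} (hM : P.card ≤ M) :
    (Set.range (cell P)).ncard ≤ (M + 1) ^ 3 := by
  classical
  -- A cell is encoded by its pivot `j` (`none` for the empty cell) and the sizes of its two halves.
  -- As the slope varies with `j` fixed, each half runs through a chain, so its size determines it
  -- and the code is injective.
  have key : ∀ S : Set.range (cell P), ∃ c : Option P × Fin (M + 1) × Fin (M + 1),
      (c.1 = none → (S : Finset (ℝ × ℝ)) = ∅) ∧ ∀ j, c.1 = some j → ∃ u,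
        (∀ p, p ∈ (S : Finset (ℝ × ℝ)) ↔ p ∈ cellRight P j u ∨ p ∈ cellLeft P j u) ∧
        (cellRight P j u).card = c.2.1 ∧ (cellLeft P j u).card = c.2.2 := by
    rintro ⟨_, x, rfl⟩
    rcases (cell P x).eq_empty_or_nonempty with h | h
    · exact ⟨(none, 0, 0), fun _ => h, fun j hj => by simp at hj⟩
    · obtain ⟨j, hj, hu⟩ := exists_cell_eq_union P x h
      refine ⟨(some ⟨j, hj⟩,
        ⟨(cellRight P j x.1).card, Nat.lt_succ_of_le ((card_filter_le _ _).trans hM)⟩,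
        ⟨(cellLeft P j x.1).card, Nat.lt_succ_of_le ((card_filter_le _ _).trans hM)⟩),
        fun h => by simp at h, ?_⟩
      rintro j' hj'
      obtain rfl : (⟨j, hj⟩ : P) = j' := by simpa using hj'
      exact ⟨x.1, hu, rfl, rfl⟩
  choose f hf0 hf1 using key
  have hinj : Function.Injective f := by
    intro S T hST
    refine Subtype.ext ?_
    rcases hS : (f S).1 with _ | j
    · rw [hf0 S hS, hf0 T (hST ▸ hS)]
    · obtain ⟨u, hu, hr, hl⟩ := hf1 S j hS
      obtain ⟨u', hu', hr', hl'⟩ := hf1 T j (hST ▸ hS)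
      rw [← hST] at hr' hl'
      have e1 := eq_of_card_eq_of_total (cellRight_total P j u u') (hr.trans hr'.symm)
      have e2 := eq_of_card_eq_of_total (cellLeft_total P j u u') (hl.trans hl'.symm)
      ext p
      rw [hu, hu', e1, e2]
  have h := Nat.card_le_card_of_injective f hinj
  rw [← Nat.card_coe_set_eq]
  refine h.trans ?_
  simp only [Nat.card_eq_fintype_card, Fintype.card_prod, Fintype.card_option, Fintype.card_coe,
    Fintype.card_fin]
  calc _ ≤ (M + 1) * ((M + 1) * (M + 1)) := by gcongr
    _ = _ := by ring

end Cells

/-! ### Optimality of zero parameters, and the geometry of the pruning tests -/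

section PruningStructure

variable {𝒳 : Type*} {n c : ℕ}

/-- The number of examples of `D` with index in `S` that `T` misclassifies. -/
def missCount (D : Dataset 𝒳 n c) (S : Finset (Fin n)) (T : DTree 𝒳 c) : ℕ :=
  (S.filter fun i => T.predict (D i).1 ≠ (D i).2).card

theorem missCount_node (D : Dataset 𝒳 n c) (S : Finset (Fin n)) (f : 𝒳 → Bool)
    (l r : DTree 𝒳 c) :
    missCount D S (.node f l r) = missCount D (S.filter fun i => f (D i).1 = false) l +
      missCount D (S.filter fun i => f (D i).1 = true) r := by
  unfold missCount
  rw [← Finset.card_filter_add_card_filter_not (fun i => f (D i).1 = false), Finset.filter_filter,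
    Finset.filter_filter, Finset.filter_filter, Finset.filter_filter]
  congr 2 <;> refine Finset.filter_congr fun i _ => ?_ <;> simp only [DTree.predict] <;>
    cases f (D i).1 <;> simp

theorem errorOn_le_errorOn_iff (D : Dataset 𝒳 n c) (S : Finset (Fin n)) (T T' : DTree 𝒳 c) :
    DTree.errorOn D S T ≤ DTree.errorOn D S T' ↔ missCount D S T ≤ missCount D S T' := by
  rcases S.eq_empty_or_nonempty with rfl | h
  · simp [DTree.errorOn, missCount]
  · have : (0 : ℝ) < S.card := by exact_mod_cast h.card_pos
    unfold DTree.errorOn missCount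
    rw [div_le_div_iff_of_pos_right this]
    exact_mod_cast Iff.rfl

theorem loss_eq_missCount (T : DTree 𝒳 c) (D : Dataset 𝒳 n c) :
    T.loss D = (1 / (n : ℝ)) * missCount D Finset.univ T := by
  rw [DTree.loss, missCount, Finset.sum_boole]

theorem loss_nonneg (T : DTree 𝒳 c) (D : Dataset 𝒳 n c) : 0 ≤ T.loss D := by
  rw [loss_eq_missCount]; positivity

theorem loss_le_one (T : DTree 𝒳 c) (D : Dataset 𝒳 n c) : T.loss D ≤ 1 := by
  rw [loss_eq_missCount, one_div_mul_eq_div]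
  refine div_le_one_of_le₀ ?_ (by positivity)
  have := Finset.card_filter_le Finset.univ fun i => T.predict (D i).1 ≠ (D i).2
  rw [Finset.card_univ, Fintype.card_fin] at this
  exact_mod_cast this

theorem size_eq_zero_iff {T : DTree 𝒳 c} : T.size = 0 ↔ ∃ k, T = .leaf k := by
  cases T <;> simp [DTree.size]

variable [NeZero c]

theorem pruneBranch_of_pass {a : ℕ} {c₁ c₂ : ℝ} {D : Dataset 𝒳 n c} {S : Finset (Fin n)}
    {f : 𝒳 → Bool} {l r : DTree 𝒳 c} (h : PessimisticTest a c₁ c₂ D S (.node f l r)) :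
    pruneBranch a c₁ c₂ D S (.node f l r) = .leaf (majorityLabel D S) := by
  rw [pruneBranch, if_pos h]

theorem pruneBranch_of_fail {a : ℕ} {c₁ c₂ : ℝ} {D : Dataset 𝒳 n c} {S : Finset (Fin n)}
    {f : 𝒳 → Bool} {l r : DTree 𝒳 c} (h : ¬ PessimisticTest a c₁ c₂ D S (.node f l r)) :
    pruneBranch a c₁ c₂ D S (.node f l r) = .node f
      (pruneBranch a c₁ c₂ D (S.filter fun i => f (D i).1 = false) l)
      (pruneBranch a c₁ c₂ D (S.filter fun i => f (D i).1 = true) r) := by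
  rw [pruneBranch, if_neg h]

theorem pessimisticTest_of_zero {a : ℕ} {c₁ c₂ : ℝ} (h₁ : 0 ≤ c₁) {D : Dataset 𝒳 n c}
    {S : Finset (Fin n)} {T : DTree 𝒳 c} (h : PessimisticTest a 0 0 D S T) :
    PessimisticTest a c₁ c₂ D S T := by
  unfold PessimisticTest at *
  rw [zero_mul, add_zero] at h
  have : 0 ≤ c₁ * √(((T.size : ℝ) * Real.log (a : ℝ) + c₂) / (S.card : ℝ)) := by positivity
  linarith

theorem pessimisticTest_zero_iff (a : ℕ) (D : Dataset 𝒳 n c)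
    (S : Finset (Fin n)) (T : DTree 𝒳 c) : PessimisticTest a 0 0 D S T ↔
      missCount D S (.leaf (majorityLabel D S)) ≤ missCount D S T := by
  rw [← errorOn_le_errorOn_iff, PessimisticTest, zero_mul, add_zero]

theorem missCount_pruneBranch_zero_le (a : ℕ) (D : Dataset 𝒳 n c) (T : DTree 𝒳 c) :
    ∀ S, missCount D S (pruneBranch a 0 0 D S T) ≤ missCount D S T := by
  induction T with
  | leaf k => intro S; simp [pruneBranch]
  | node f l r ihl ihr =>
    intro S
    rw [pruneBranch]
    split_ifs with h
    · exact (pessimisticTest_zero_iff a D S _).1 h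
    · rw [missCount_node, missCount_node]
      exact add_le_add (ihl _) (ihr _)

/-- Pruning with both parameters equal to `0` minimizes the training error. -/
theorem missCount_pruneBranch_zero_le_pruneBranch (a : ℕ) {c₁ c₂ : ℝ} (h₁ : 0 ≤ c₁)
    (D : Dataset 𝒳 n c) (T : DTree 𝒳 c) :
    ∀ S, missCount D S (pruneBranch a 0 0 D S T) ≤
      missCount D S (pruneBranch a c₁ c₂ D S T) := by
  induction T with
  | leaf k => intro S; simp [pruneBranch]
  | node f l r ihl ihr =>
    intro S
    by_cases h0 : PessimisticTest a 0 0 D S (.node f l r)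
    · rw [pruneBranch_of_pass h0, pruneBranch_of_pass (pessimisticTest_of_zero h₁ h0)]
    · by_cases h : PessimisticTest a c₁ c₂ D S (.node f l r)
      -- Failing the test at `(0, 0)` means that the leaf is strictly worse than the unpruned
      -- sub-tree, which pruning at `(0, 0)` does not worsen.
      · refine (missCount_pruneBranch_zero_le a D _ S).trans ?_
        rw [pruneBranch_of_pass h]
        exact (not_le.1 fun h' => h0 ((pessimisticTest_zero_iff a D S _).2 h')).le
      · rw [pruneBranch_of_fail h0, pruneBranch_of_fail h, missCount_node, missCount_node]
        exact add_le_add (ihl _) (ihr _)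

theorem prunedLoss_zero_le (a : ℕ) (grow : Dataset 𝒳 n c → DTree 𝒳 c) {c₁ c₂ : ℝ}
    (h₁ : 0 ≤ c₁) (D : Dataset 𝒳 n c) : prunedLoss a grow 0 0 D ≤ prunedLoss a grow c₁ c₂ D := by
  unfold prunedLoss
  rw [loss_eq_missCount, loss_eq_missCount]
  have := missCount_pruneBranch_zero_le_pruneBranch a (c₂ := c₂) h₁ D (grow D) Finset.univ
  gcongr

/-- The half-plane `(τ, r)` of parameters, in the coordinates `u = c₁²`, `v = c₁² c₂`, for which a
node passes the pruning test: `r ≤ u τ + v`. -/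
noncomputable def testLine (a : ℕ) (D : Dataset 𝒳 n c) (S : Finset (Fin n)) (T : DTree 𝒳 c) :
    ℝ × ℝ :=
  ((T.size : ℝ) * Real.log a,
    (max (DTree.errorOn D S (DTree.leaf (majorityLabel D S)) - DTree.errorOn D S T) 0) ^ 2 * S.card)

/-- The coordinates in which the pruning tests are half-planes. -/
def testCoord (x : ℝ × ℝ) : ℝ × ℝ := (x.1 ^ 2, x.1 ^ 2 * x.2)

/-- Squaring the test linearizes it. Truncating the error difference at `0` makes the squaring
reversible, since the right side is nonnegative. -/
theorem pessimisticTest_iff (a : ℕ) {x : ℝ × ℝ} (h₁ : 0 ≤ x.1) (h₂ : 0 ≤ x.2)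
    (D : Dataset 𝒳 n c) (S : Finset (Fin n)) (T : DTree 𝒳 c) :
    PessimisticTest a x.1 x.2 D S T ↔
      (testLine a D S T).2 ≤ (testCoord x).1 * (testLine a D S T).1 + (testCoord x).2 := by
  simp only [PessimisticTest, testLine, testCoord]
  have hw : 0 ≤ (T.size : ℝ) * Real.log a + x.2 := by
    have := Real.log_natCast_nonneg a
    positivity
  set w := (T.size : ℝ) * Real.log a + x.2 with hwdef
  set e := DTree.errorOn D S (DTree.leaf (majorityLabel D S)) with he
  set e' := DTree.errorOn D S T with he'
  have hrhs : x.1 ^ 2 * (↑T.size * Real.log a) + x.1 ^ 2 * x.2 = x.1 ^ 2 * w := by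
    rw [hwdef]; ring
  rw [hrhs, ← sub_le_iff_le_add']
  have hpos : 0 ≤ x.1 * √(w / S.card) := by positivity
  -- With no examples, division by zero makes all fractions `0`, so both sides of the equivalence
  -- hold.
  rcases S.eq_empty_or_nonempty with rfl | hS
  · simp only [Finset.card_empty, Nat.cast_zero, mul_zero, div_zero, Real.sqrt_zero]
    refine iff_of_true ?_ (by positivity)
    simp [he, he', DTree.errorOn]
  · have hcard : (0 : ℝ) < S.card := by exact_mod_cast hS.card_pos
    rw [show ∀ d : ℝ, d ≤ x.1 * √(w / S.card) ↔ max d 0 ≤ x.1 * √(w / S.card) from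
        fun d => by rw [max_le_iff, and_iff_left hpos], ← sq_le_sq₀ (le_max_right _ _) hpos, mul_pow,
      Real.sq_sqrt (by positivity), ← mul_div_assoc, le_div_iff₀ hcard]

open Classical in
/-- The half-planes of the tests at all internal nodes of `T`. -/
noncomputable def testLines (a : ℕ) (D : Dataset 𝒳 n c) :
    Finset (Fin n) → DTree 𝒳 c → Finset (ℝ × ℝ)
  | _, .leaf _ => ∅
  | S, .node f l r => insert (testLine a D S (.node f l r))
      (testLines a D (S.filter fun i => f (D i).1 = false) l ∪
        testLines a D (S.filter fun i => f (D i).1 = true) r)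

theorem card_testLines_le (a : ℕ) (D : Dataset 𝒳 n c) (T : DTree 𝒳 c) :
    ∀ S, (testLines a D S T).card ≤ T.size := by
  classical
  induction T with
  | leaf k => intro S; simp [testLines]
  | node f l r ihl ihr =>
    intro S
    rw [testLines, DTree.size]
    refine (Finset.card_insert_le _ _).trans (Nat.succ_le_succ ?_)
    exact (Finset.card_union_le _ _).trans (add_le_add (ihl _) (ihr _))

theorem pruneBranch_congr (a : ℕ) {x y : ℝ × ℝ} (hx₁ : 0 ≤ x.1) (hx₂ : 0 ≤ x.2)
    (hy₁ : 0 ≤ y.1) (hy₂ : 0 ≤ y.2) (D : Dataset 𝒳 n c) (T : DTree 𝒳 c) :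
    ∀ S, (∀ p ∈ testLines a D S T, p.2 ≤ (testCoord x).1 * p.1 + (testCoord x).2 ↔
        p.2 ≤ (testCoord y).1 * p.1 + (testCoord y).2) →
      pruneBranch a x.1 x.2 D S T = pruneBranch a y.1 y.2 D S T := by
  classical
  induction T with
  | leaf k => intro S _; simp [pruneBranch]
  | node f l r ihl ihr =>
    intro S h
    rw [testLines] at h
    have h0 : PessimisticTest a x.1 x.2 D S (.node f l r) ↔
        PessimisticTest a y.1 y.2 D S (.node f l r) := by
      rw [pessimisticTest_iff a hx₁ hx₂, pessimisticTest_iff a hy₁ hy₂]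
      exact h _ (Finset.mem_insert_self _ _)
    rw [pruneBranch, pruneBranch,
      ihl _ fun p hp => h p (Finset.mem_insert_of_mem (Finset.mem_union_left _ hp)),
      ihr _ fun p hp => h p (Finset.mem_insert_of_mem (Finset.mem_union_right _ hp))]
    simp only [h0]

/-- The instances on which the parameters `x` are worse than `(0, 0)`. -/
def worseSet (a : ℕ) (grow : Dataset 𝒳 n c → DTree 𝒳 c) (x : ℝ × ℝ) : Set (Dataset 𝒳 n c) :=
  {D | prunedLoss a grow 0 0 D < prunedLoss a grow x.1 x.2 D}

/-- The parameter space `[0,∞)²`. -/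
abbrev Params : Type := {x : ℝ × ℝ // 0 ≤ x.1 ∧ 0 ≤ x.2}

theorem mem_worseSet_congr (a : ℕ) (grow : Dataset 𝒳 n c → DTree 𝒳 c) (x y : Params)
    (D : Dataset 𝒳 n c)
    (h : ∀ p ∈ testLines a D Finset.univ (grow D),
      p.2 ≤ (testCoord x).1 * p.1 + (testCoord x).2 ↔
        p.2 ≤ (testCoord y).1 * p.1 + (testCoord y).2) :
    D ∈ worseSet a grow x ↔ D ∈ worseSet a grow y := by
  simp only [worseSet, Set.mem_ofPred_eq, prunedLoss,
    pruneBranch_congr a x.2.1 x.2.2 y.2.1 y.2.2 D (grow D) _ h]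

/-- The number of membership patterns of the sets `worseSet` on `N` pairs of instances. -/
theorem ncard_range_pairPattern_worseSet_le (a : ℕ) (grow : Dataset 𝒳 n c → DTree 𝒳 c) {t : ℕ}
    (ht : ∀ D, (grow D).size ≤ t) {N : ℕ} (z : Fin N → Dataset 𝒳 n c × Dataset 𝒳 n c) :
    (Set.range fun x : Params => pairPattern (worseSet a grow x) z).ncard ≤
      (2 * N * t + 1) ^ 3 := by
  classical
  set L : Dataset 𝒳 n c → Finset (ℝ × ℝ) := fun D => testLines a D Finset.univ (grow D) with hL
  have hLc : ∀ D, (L D).card ≤ t := fun D => (card_testLines_le a D _ _).trans (ht D)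
  set P : Finset (ℝ × ℝ) := Finset.univ.biUnion fun k => L (z k).1 ∪ L (z k).2 with hP
  have hPc : P.card ≤ 2 * N * t := by
    calc P.card ≤ (Finset.univ : Finset (Fin N)).card * (2 * t) := by
          refine Finset.card_biUnion_le_card_mul _ _ _ fun k _ => ?_
          refine (Finset.card_union_le _ _).trans ?_
          have h1 := hLc (z k).1
          have h2 := hLc (z k).2
          omega
      _ = 2 * N * t := by simp; ring
  have hfac : ∀ x y : Params, cell P (testCoord x) = cell P (testCoord y) →
      pairPattern (worseSet a grow x) z = pairPattern (worseSet a grow y) z := by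
    intro x y hxy
    have hiff : ∀ p ∈ P, (p.2 ≤ (testCoord x).1 * p.1 + (testCoord x).2 ↔
        p.2 ≤ (testCoord y).1 * p.1 + (testCoord y).2) := by
      intro p hp
      have := Finset.ext_iff.1 hxy p
      simpa [cell, hp] using this
    funext k
    have hk1 := mem_worseSet_congr a grow x y (z k).1 fun p hp => hiff p <|
      Finset.mem_biUnion.2 ⟨k, Finset.mem_univ _, Finset.mem_union_left _ hp⟩
    have hk2 := mem_worseSet_congr a grow x y (z k).2 fun p hp => hiff p <|
      Finset.mem_biUnion.2 ⟨k, Finset.mem_univ _, Finset.mem_union_right _ hp⟩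
    simp only [pairPattern, hk1, hk2]
  have hfin : (Set.range (cell P)).Finite :=
    (P.powerset.finite_toSet).subset (by
      rintro _ ⟨x, rfl⟩
      exact Finset.mem_coe.2 (Finset.mem_powerset.2 (Finset.filter_subset _ _)))
  refine le_trans ?_ (ncard_range_cell_le P hPc)
  have : Nonempty Params := ⟨⟨(0, 0), le_rfl, le_rfl⟩⟩
  -- One representative parameter per attained cell: patterns are constant on cells, so they number
  -- at most as many as the cells.
  choose! g hg using fun (A : Finset (ℝ × ℝ)) (hA : ∃ x : Params, cell P (testCoord x) = A) => hA
  refine le_trans (Set.ncard_le_ncard (t := (fun A => pairPattern (worseSet a grow (g A)) z) ''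
    Set.range (cell P)) ?_ (hfin.image _)) (Set.ncard_image_le hfin)
  rintro _ ⟨x, rfl⟩
  exact ⟨cell P (testCoord x), ⟨_, rfl⟩, hfac _ _ (hg _ ⟨x, rfl⟩)⟩

/-- For trees with at most one internal node the sets `worseSet` form a chain. -/
theorem worseSet_chain (a : ℕ) (grow : Dataset 𝒳 n c → DTree 𝒳 c)
    (ht : ∀ D, (grow D).size ≤ 1) (x y : Params) :
    worseSet a grow x ⊆ worseSet a grow y ∨ worseSet a grow y ⊆ worseSet a grow x := by
  have key : ∀ x y : Params,
      (testCoord x).1 * Real.log a + (testCoord x).2 ≤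
        (testCoord y).1 * Real.log a + (testCoord y).2 →
      worseSet a grow x ⊆ worseSet a grow y := by
    intro x y hxy D hD
    have hs := ht D
    simp only [worseSet, prunedLoss, Set.mem_ofPred_eq] at hD ⊢
    cases hT : grow D with
    | leaf k => rw [hT] at hD; simp [pruneBranch] at hD
    | node f l r =>
      rw [hT] at hD hs
      simp only [DTree.size] at hs
      obtain ⟨k, rfl⟩ := size_eq_zero_iff.1 (show l.size = 0 by omega)
      obtain ⟨m, rfl⟩ := size_eq_zero_iff.1 (show r.size = 0 by omega)
      -- If the only test failed at `x`, it would fail at `(0, 0)` too, and both pruned trees would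
      -- equal the unpruned one.
      have hx : PessimisticTest a x.1.1 x.1.2 D Finset.univ (.node f (.leaf k) (.leaf m)) := by
        by_contra hx
        have h0 : ¬ PessimisticTest a 0 0 D Finset.univ (.node f (.leaf k) (.leaf m)) :=
          fun h => hx (pessimisticTest_of_zero x.2.1 h)
        rw [pruneBranch_of_fail hx, pruneBranch_of_fail h0] at hD
        simp [pruneBranch] at hD
      have hy : PessimisticTest a y.1.1 y.1.2 D Finset.univ (.node f (.leaf k) (.leaf m)) := by
        rw [pessimisticTest_iff a x.2.1 x.2.2] at hx
        rw [pessimisticTest_iff a y.2.1 y.2.2]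
        have : (testLine a D Finset.univ (.node f (.leaf k) (.leaf m))).1 = Real.log a := by
          simp [testLine, DTree.size]
        rw [this] at hx ⊢
        exact hx.trans hxy
      rw [pruneBranch_of_pass hx] at hD
      rw [pruneBranch_of_pass hy]
      exact hD
  exact (le_total _ _).imp (key x y) (key y x)

end PruningStructure

/-! ### Reduction to finitely many types of instances -/

section Signature

variable {𝒳 : Type*} {n c : ℕ}

/-- Two datasets that no function of `F` and no label tells apart. -/
def Indist (F : Set (𝒳 → Bool)) (D D' : Dataset 𝒳 n c) : Prop :=
  (∀ f ∈ F, ∀ i, f (D i).1 = f (D' i).1) ∧ ∀ i, (D i).2 = (D' i).2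

theorem Indist.predict_eq {F : Set (𝒳 → Bool)} {D D' : Dataset 𝒳 n c} (h : Indist F D D')
    {T : DTree 𝒳 c} (hT : T.NodesIn F) (i : Fin n) :
    T.predict (D i).1 = T.predict (D' i).1 := by
  induction T with
  | leaf k => rfl
  | node f l r ihl ihr => rw [DTree.predict, DTree.predict, h.1 f hT.1 i, ihl hT.2.1, ihr hT.2.2]

theorem Indist.errorOn_eq {F : Set (𝒳 → Bool)} {D D' : Dataset 𝒳 n c} (h : Indist F D D')
    {T : DTree 𝒳 c} (hT : T.NodesIn F) (S : Finset (Fin n)) :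
    DTree.errorOn D S T = DTree.errorOn D' S T := by
  simp only [DTree.errorOn, h.predict_eq hT, h.2]

theorem Indist.loss_eq {F : Set (𝒳 → Bool)} {D D' : Dataset 𝒳 n c} (h : Indist F D D')
    {T : DTree 𝒳 c} (hT : T.NodesIn F) : T.loss D = T.loss D' := by
  simp only [DTree.loss, h.predict_eq hT, h.2]

theorem finite_nodesIn_size_le {F : Set (𝒳 → Bool)} (hF : F.Finite) (t : ℕ) :
    {T : DTree 𝒳 c | T.NodesIn F ∧ T.size ≤ t}.Finite := by
  induction t with
  | zero =>
    refine (Set.finite_range (DTree.leaf : Fin c → DTree 𝒳 c)).subset ?_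
    rintro T ⟨-, hT⟩
    obtain ⟨k, rfl⟩ := size_eq_zero_iff.1 (Nat.le_zero.1 hT)
    exact ⟨k, rfl⟩
  | succ t ih =>
    refine ((Set.finite_range (DTree.leaf : Fin c → DTree 𝒳 c)).union
      ((hF.prod (ih.prod ih)).image fun p => DTree.node p.1 p.2.1 p.2.2)).subset ?_
    rintro (k | ⟨f, l, r⟩) ⟨hT, hs⟩
    · exact Or.inl ⟨k, rfl⟩
    · rw [DTree.size] at hs
      have hl : l.size ≤ t := by omega
      have hr : r.size ≤ t := by omega
      exact Or.inr ⟨(f, l, r), ⟨hT.1, ⟨hT.2.1, hl⟩, ⟨hT.2.2, hr⟩⟩, rfl⟩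

/-- The data of an instance that determine all pruned losses. -/
def signature (F : Set (𝒳 → Bool)) (grow : Dataset 𝒳 n c → DTree 𝒳 c) (D : Dataset 𝒳 n c) :
    DTree 𝒳 c × (Fin n → F → Bool) × (Fin n → Fin c) :=
  (grow D, fun i f => f.1 (D i).1, fun i => (D i).2)

theorem finite_range_signature {F : Set (𝒳 → Bool)} (hfin : F.Finite)
    {grow : Dataset 𝒳 n c → DTree 𝒳 c} (hF : ∀ D, (grow D).NodesIn F) {t : ℕ}
    (ht : ∀ D, (grow D).size ≤ t) : (Set.range (signature F grow)).Finite := by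
  have := hfin.to_subtype
  refine ((finite_nodesIn_size_le (c := c) hfin t).prod
    (Set.finite_univ (α := (Fin n → F → Bool) × (Fin n → Fin c)))).subset ?_
  rintro _ ⟨D, rfl⟩
  exact ⟨⟨hF D, ht D⟩, trivial⟩

theorem measurableSet_signature_fiber [MeasurableSpace 𝒳] {F : Set (𝒳 → Bool)} (hfin : F.Finite)
    (hmeas : ∀ f ∈ F, Measurable f) {grow : Dataset 𝒳 n c → DTree 𝒳 c}
    (hgrow : ∀ T : DTree 𝒳 c, MeasurableSet {D | grow D = T})
    (z : DTree 𝒳 c × (Fin n → F → Bool) × (Fin n → Fin c)) :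
    MeasurableSet (signature F grow ⁻¹' {z}) := by
  have := hfin.to_subtype
  have hset : signature F grow ⁻¹' {z} = {D | grow D = z.1} ∩
      ((⋂ i, ⋂ f : F, (fun D : Dataset 𝒳 n c => f.1 (D i).1) ⁻¹' {z.2.1 i f}) ∩
        ⋂ i, (fun D : Dataset 𝒳 n c => (D i).2) ⁻¹' {z.2.2 i}) := by
    ext D
    simp [signature, Prod.ext_iff, funext_iff]
  rw [hset]
  refine (hgrow _).inter ((MeasurableSet.iInter fun i => MeasurableSet.iInter fun f => ?_).inter
    (MeasurableSet.iInter fun i => ?_))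
  · exact ((hmeas f f.2).comp (measurable_fst.comp (measurable_pi_apply i)))
      (measurableSet_singleton _)
  · exact (measurable_snd.comp (measurable_pi_apply i)) (measurableSet_singleton _)

variable [NeZero c]

/-- The choice is made from a predicate that involves the dataset only through `labelCount`, so even
ties are broken alike. -/
theorem Indist.majorityLabel_eq {F : Set (𝒳 → Bool)} {D D' : Dataset 𝒳 n c}
    (h : Indist F D D') (S : Finset (Fin n)) : majorityLabel D S = majorityLabel D' S := by
  have : labelCount D S = labelCount D' S := by funext k; simp only [labelCount, h.2]
  simp only [majorityLabel, this]

theorem Indist.pessimisticTest_iff {F : Set (𝒳 → Bool)} {D D' : Dataset 𝒳 n c}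
    (h : Indist F D D') {T : DTree 𝒳 c} (hT : T.NodesIn F) (a : ℕ) (c₁ c₂ : ℝ)
    (S : Finset (Fin n)) :
    PessimisticTest a c₁ c₂ D S T ↔ PessimisticTest a c₁ c₂ D' S T := by
  rw [PessimisticTest, PessimisticTest, h.errorOn_eq hT, h.majorityLabel_eq,
    h.errorOn_eq (T := .leaf _) trivial]

theorem Indist.pruneBranch_eq {F : Set (𝒳 → Bool)} {D D' : Dataset 𝒳 n c}
    (h : Indist F D D') (a : ℕ) (c₁ c₂ : ℝ) {T : DTree 𝒳 c} (hT : T.NodesIn F) :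
    ∀ S, pruneBranch a c₁ c₂ D S T = pruneBranch a c₁ c₂ D' S T := by
  induction T with
  | leaf k => intro S; simp [pruneBranch]
  | node f l r ihl ihr =>
    intro S
    by_cases ht : PessimisticTest a c₁ c₂ D S (.node f l r)
    · rw [pruneBranch_of_pass ht, pruneBranch_of_pass ((h.pessimisticTest_iff hT _ _ _ _).1 ht),
        h.majorityLabel_eq]
    · rw [pruneBranch_of_fail ht,
        pruneBranch_of_fail (fun h' => ht ((h.pessimisticTest_iff hT _ _ _ _).2 h')),
        ihl hT.2.1, ihr hT.2.2]
      simp only [h.1 f hT.1]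

theorem nodesIn_pruneBranch {F : Set (𝒳 → Bool)} (a : ℕ) (c₁ c₂ : ℝ) (D : Dataset 𝒳 n c)
    {T : DTree 𝒳 c} (hT : T.NodesIn F) : ∀ S, (pruneBranch a c₁ c₂ D S T).NodesIn F := by
  induction T with
  | leaf k => intro S; simp [pruneBranch, DTree.NodesIn]
  | node f l r ihl ihr =>
    intro S
    by_cases ht : PessimisticTest a c₁ c₂ D S (.node f l r)
    · rw [pruneBranch_of_pass ht]; trivial
    · rw [pruneBranch_of_fail ht]
      exact ⟨hT.1, ihl hT.2.1 _, ihr hT.2.2 _⟩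

theorem Indist.prunedLoss_eq {F : Set (𝒳 → Bool)} {D D' : Dataset 𝒳 n c} (h : Indist F D D')
    {grow : Dataset 𝒳 n c → DTree 𝒳 c} (hF : ∀ D, (grow D).NodesIn F)
    (hg : grow D = grow D') (a : ℕ) (c₁ c₂ : ℝ) :
    prunedLoss a grow c₁ c₂ D = prunedLoss a grow c₁ c₂ D' := by
  rw [prunedLoss, prunedLoss, ← hg, h.pruneBranch_eq a c₁ c₂ (hF D),
    h.loss_eq (nodesIn_pruneBranch a c₁ c₂ D' (hF D) _)]

theorem prunedLoss_eq_of_signature_eq {F : Set (𝒳 → Bool)}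
    {grow : Dataset 𝒳 n c → DTree 𝒳 c} (hF : ∀ D, (grow D).NodesIn F) {D D' : Dataset 𝒳 n c}
    (h : signature F grow D = signature F grow D') (a : ℕ) (c₁ c₂ : ℝ) :
    prunedLoss a grow c₁ c₂ D = prunedLoss a grow c₁ c₂ D' := by
  simp only [signature, Prod.mk.injEq, funext_iff] at h
  exact Indist.prunedLoss_eq ⟨fun f hf i => h.2.1 i ⟨f, hf⟩, h.2.2⟩ hF h.1 a c₁ c₂

end Signature

/-! ### Measurability and finiteness of unions of fibers -/

section Saturated

variable {Ω Z : Type*}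

/-- A union of fibers of a map with finitely many, measurable fibers is measurable. -/
theorem measurableSet_of_saturated [MeasurableSpace Ω] {φ : Ω → Z} (hfin : (Set.range φ).Finite)
    (hm : ∀ z, MeasurableSet (φ ⁻¹' {z})) {A : Set Ω}
    (hA : ∀ x y, φ x = φ y → (x ∈ A ↔ y ∈ A)) : MeasurableSet A := by
  have : A = ⋃ z ∈ φ '' A, φ ⁻¹' {z} := by
    ext x
    simp only [Set.mem_iUnion, Set.mem_image, Set.mem_preimage, Set.mem_singleton_iff]
    constructor
    · intro hx; exact ⟨φ x, ⟨x, hx, rfl⟩, rfl⟩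
    · rintro ⟨_, ⟨y, hy, rfl⟩, hxy⟩; exact (hA x y hxy).2 hy
  rw [this]
  exact MeasurableSet.biUnion (hfin.subset (Set.image_subset_range φ A)).countable fun z _ => hm z

/-- There are finitely many unions of fibers of a map with finite range. -/
theorem finite_saturated {φ : Ω → Z} (hfin : (Set.range φ).Finite) :
    {A : Set Ω | ∀ x y, φ x = φ y → (x ∈ A ↔ y ∈ A)}.Finite := by
  refine (hfin.finite_subsets.image fun B => φ ⁻¹' B).subset fun A hA => ?_
  refine ⟨φ '' A, Set.image_subset_range φ A, ?_⟩
  ext x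
  constructor
  · rintro ⟨y, hy, hxy⟩; exact (hA x y hxy.symm).2 hy
  · intro hx; exact ⟨x, hx, rfl⟩

end Saturated

/-! ### From missed sets to ε-optimality -/

section Optimality

variable {𝒳 : Type*} {n c : ℕ} [NeZero c]

theorem isERM_zero (a : ℕ) (grow : Dataset 𝒳 n c → DTree 𝒳 c) {N : ℕ}
    (Ds : Fin N → Dataset 𝒳 n c) : IsERM a grow Ds 0 0 :=
  ⟨le_rfl, le_rfl, fun _ _ h₁ _ => Finset.sum_le_sum fun i _ => prunedLoss_zero_le a grow h₁ (Ds i)⟩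

theorem IsERM.notMem_worseSet {a : ℕ} {grow : Dataset 𝒳 n c → DTree 𝒳 c} {N : ℕ}
    {Ds : Fin N → Dataset 𝒳 n c} {c₁ c₂ : ℝ} (h : IsERM a grow Ds c₁ c₂) (k : Fin N) :
    Ds k ∉ worseSet a grow (c₁, c₂) := fun hk =>
  (h.2.2 0 0 le_rfl le_rfl).not_gt <| Finset.sum_lt_sum
    (fun i _ => prunedLoss_zero_le a grow h.1 (Ds i)) ⟨k, Finset.mem_univ k, hk⟩

/-- Off `worseSet` the loss is at most that of `(0, 0)`, and on it the excess is at most `1`.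
Comparison with `(0, 0)` suffices because it is pointwise optimal. -/
theorem isEpsOptimal_of_measure_worseSet_le [MeasurableSpace 𝒳] {a : ℕ}
    {grow : Dataset 𝒳 n c → DTree 𝒳 c} {μ : Measure (Dataset 𝒳 n c)} [IsProbabilityMeasure μ]
    (hm : ∀ c₁ c₂, Measurable (prunedLoss a grow c₁ c₂)) {ε c₁ c₂ : ℝ} (hε : 0 ≤ ε)
    (h : μ (worseSet a grow (c₁, c₂)) ≤ ENNReal.ofReal ε) : IsEpsOptimal a grow μ ε c₁ c₂ := by
  have hint : ∀ b₁ b₂, Integrable (prunedLoss a grow b₁ b₂) μ := fun b₁ b₂ =>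
    Integrable.of_bound (hm b₁ b₂).aestronglyMeasurable 1 <| Filter.Eventually.of_forall fun D => by
      rw [prunedLoss, Real.norm_of_nonneg (loss_nonneg _ _)]
      exact loss_le_one _ _
  have hmw : MeasurableSet (worseSet a grow (c₁, c₂)) := measurableSet_lt (hm 0 0) (hm c₁ c₂)
  intro b₁ b₂ hb₁ _
  have h1 : ∫ D, prunedLoss a grow 0 0 D ∂μ ≤ ∫ D, prunedLoss a grow b₁ b₂ D ∂μ :=
    integral_mono (hint 0 0) (hint b₁ b₂) fun D => prunedLoss_zero_le a grow hb₁ D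
  have h2 : ∫ D, prunedLoss a grow c₁ c₂ D ∂μ ≤
      ∫ D, (prunedLoss a grow 0 0 D + (worseSet a grow (c₁, c₂)).indicator 1 D) ∂μ := by
    refine integral_mono (hint c₁ c₂)
      ((hint 0 0).add ((integrable_const (1 : ℝ)).indicator hmw)) fun D => ?_
    by_cases hD : D ∈ worseSet a grow (c₁, c₂)
    · simp only [Set.indicator_of_mem hD, Pi.one_apply]
      have h3 : prunedLoss a grow c₁ c₂ D ≤ 1 := loss_le_one _ _
      have h4 : 0 ≤ prunedLoss a grow 0 0 D := loss_nonneg _ _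
      linarith
    · simp only [Set.indicator_of_notMem hD, add_zero]
      exact not_lt.1 hD
  have hadd := integral_add (hint 0 0) ((integrable_const (1 : ℝ)).indicator hmw)
  have hone := integral_indicator_one (μ := μ) hmw
  change _ = _ + ∫ D, (worseSet a grow (c₁, c₂)).indicator 1 D ∂μ at hadd
  rw [hone] at hadd
  change ∫ D, (prunedLoss a grow 0 0 D + (worseSet a grow (c₁, c₂)).indicator 1 D) ∂μ = _ at hadd
  rw [hadd] at h2
  have h5 : μ.real (worseSet a grow (c₁, c₂)) ≤ ε := ENNReal.toReal_le_of_le_ofReal hε h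
  linarith

end Optimality

/-! ### Numerical estimates for the sample size -/

section SampleSize

theorem half_le_log_one_add {ε : ℝ} (h0 : 0 ≤ ε) (h1 : ε ≤ 1) : ε / 2 ≤ Real.log (1 + ε) := by
  have h := Real.one_sub_inv_le_log_of_pos (show 0 < 1 + ε by linarith)
  refine le_trans ?_ h
  rw [← sub_nonneg]
  have : 1 - (1 + ε)⁻¹ - ε / 2 = ε * (1 - ε) / (2 * (1 + ε)) := by
    field_simp; ring
  rw [this]
  have := sub_nonneg.2 h1
  positivity

theorem one_sub_pow_le_of_sampleSize {ε δ : ℝ} (hε : 0 < ε) (hε1 : ε < 1) (hδ : 0 < δ) {N : ℕ}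
    (hN : 200 * (1 / ε ^ 2 * Real.log (1 / δ)) ≤ N) : (1 - ε) ^ N ≤ δ := by
  rw [one_div_mul_eq_div, ← mul_div_assoc, div_le_iff₀ (by positivity)] at hN
  have h1 : (1 - ε) ^ N ≤ Real.exp (-ε) ^ N :=
    pow_le_pow_left₀ (by linarith) (by linarith [Real.add_one_le_exp (-ε)]) N
  refine h1.trans ?_
  rw [← Real.exp_nat_mul, ← Real.le_log_iff_exp_le hδ]
  rw [one_div, Real.log_inv] at hN
  have h2 : (N : ℝ) * ε ^ 2 ≤ N * ε := by
    gcongr; nlinarith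
  rcases le_or_gt 0 (Real.log δ) with h | h
  · have : 0 ≤ (N : ℝ) * ε := by positivity
    linarith
  · linarith

theorem growth_le_of_sampleSize {ε δ : ℝ} (hε : 0 < ε) (hε1 : ε < 1) (hδ : 0 < δ) (hδ1 : δ < 1)
    {t N : ℕ} (ht : 2 ≤ t)
    (hN : 200 * (1 / ε ^ 2 * (Real.log t + Real.log (1 / δ))) ≤ N) :
    ((2 * N * t + 1) ^ 3 : ℝ) ≤ δ * (1 + ε) ^ N := by
  rw [one_div_mul_eq_div, ← mul_div_assoc, div_le_iff₀ (by positivity), one_div, Real.log_inv] at hN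
  have htR : (2 : ℝ) ≤ t := by exact_mod_cast ht
  have hlogδ : Real.log δ < 0 := Real.log_neg hδ hδ1
  have hlogt : Real.log 2 ≤ Real.log t := Real.log_le_log (by norm_num) htR
  have hlog2 : 0.69 < Real.log 2 := by linarith [Real.log_two_gt_d9]
  set L := Real.log t + -Real.log δ with hL
  have hN0 : 0 < N := by
    rcases Nat.eq_zero_or_pos N with rfl | h
    · simp only [Nat.cast_zero, zero_mul] at hN; linarith
    · exact h
  have hN1 : (1 : ℝ) ≤ N := by exact_mod_cast hN0
  set y := ε * N with hy
  have hy0 : 0 < y := by positivity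
  have hyL : 200 * L ≤ y := by
    have : (N : ℝ) * ε ^ 2 ≤ y := by
      rw [hy, mul_comm]; gcongr; nlinarith
    linarith
  -- Here the `1/ε²` rate is used: `N ε² ≥ 200 L ≥ 1`, so `log N` is controlled by `log (ε N)`.
  have hyN : (N : ℝ) ≤ y ^ 2 := by
    have : y ^ 2 = (N * ε ^ 2) * N := by rw [hy]; ring
    rw [this]
    nlinarith
  have hlogN : Real.log N ≤ 2 * Real.log y := by
    have := Real.log_le_log (by linarith) hyN
    rwa [Real.log_pow] at this
  -- Rescaling by `64` keeps `3 log N ≤ 6 log y` below `6y/64` plus constants, well under the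
  -- available `y/2`. The rest of `y/2` is over `80 L`, which absorbs the constants since `L ≥ log
  -- 2`.
  have hlogy : Real.log y ≤ y / 64 - 1 + 6 * Real.log 2 := by
    have h1 := Real.log_le_sub_one_of_pos (show 0 < y / 64 by positivity)
    rw [Real.log_div hy0.ne' (by norm_num), show (64 : ℝ) = 2 ^ 6 by norm_num, Real.log_pow] at h1
    push_cast at h1
    norm_num at h1 ⊢
    linarith
  have hlog3 : Real.log 3 ≤ 2 * Real.log 2 := by
    have := Real.log_le_log (by norm_num) (show (3 : ℝ) ≤ 2 ^ 2 by norm_num)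
    rwa [Real.log_pow] at this
  have hbase : (2 * N * t + 1 : ℝ) ≤ 3 * N * t := by nlinarith
  have hlog := half_le_log_one_add hε.le hε1.le
  calc ((2 * N * t + 1) ^ 3 : ℝ) ≤ (3 * N * t) ^ 3 := by gcongr
    _ ≤ δ * (1 + ε) ^ N := by
      rw [← Real.log_le_log_iff (by positivity) (by positivity), Real.log_pow,
        Real.log_mul (by positivity) (by positivity), Real.log_mul (by positivity) (by positivity),
        Real.log_mul (by positivity) (by positivity), Real.log_pow]
      have h2 : y / 2 ≤ N * Real.log (1 + ε) := by
        rw [hy]; nlinarith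
      push_cast
      linarith

end SampleSize

/-! ### The sample complexity bound -/

theorem mainTheorem6 :
    ∃ C : ℝ, 0 < C ∧
      ∀ (a n c t : ℕ) [NeZero c], 1 ≤ a → 1 ≤ n → 1 ≤ t →
      ∀ (𝒳 : Set (Fin a → ℝ)) (F : Set (𝒳 → Bool)), F.Finite → (∀ f ∈ F, Measurable f) →
      ∀ grow : Dataset 𝒳 n c → DTree 𝒳 c,
        (∀ D, (grow D).NodesIn F) →
        (∀ D, (grow D).size ≤ t) →
        (∀ T : DTree 𝒳 c, MeasurableSet {D | grow D = T}) →
      ∀ (μ : Measure (Dataset 𝒳 n c)) [IsProbabilityMeasure μ] (ε δ : ℝ), 0 < ε → 0 < δ →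
      ∀ N : ℕ, C * (1 / ε ^ 2 * (Real.log t + Real.log (1 / δ))) ≤ N →
        (∀ Ds : Fin N → Dataset 𝒳 n c, ∃ c₁ c₂ : ℝ, IsERM a grow Ds c₁ c₂) ∧
        (Measure.pi fun _ : Fin N => μ)
            {Ds | ¬ ∀ c₁ c₂ : ℝ, IsERM a grow Ds c₁ c₂ → IsEpsOptimal a grow μ ε c₁ c₂}
          ≤ ENNReal.ofReal δ := by
  refine ⟨200, by norm_num, ?_⟩
  intro a n c t _ _ _ ht 𝒳 F hfin hFm grow hF hsize hgrow μ _ ε δ hε hδ N hN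
  refine ⟨fun Ds => ⟨0, 0, isERM_zero a grow Ds⟩, ?_⟩
  have hsig := finite_range_signature hfin hF hsize
  have hfib := measurableSet_signature_fiber hfin hFm hgrow
  have hm : ∀ c₁ c₂, Measurable (prunedLoss a grow c₁ c₂) := fun c₁ c₂ s _ =>
    measurableSet_of_saturated hsig hfib fun D D' h => by
      rw [Set.mem_preimage, Set.mem_preimage, prunedLoss_eq_of_signature_eq hF h]
  set 𝓗 : Set (Set (Dataset 𝒳 n c)) := Set.range fun x : Params => worseSet a grow x with h𝓗
  -- Parameters form a continuum, but each `worseSet` is a union of fibers of a map with finite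
  -- range. The ε-net bounds therefore concern a finite family.
  have h𝓗fin : 𝓗.Finite := (finite_saturated hsig).subset (by
    rintro _ ⟨x, rfl⟩ D D' h
    simp only [worseSet, Set.mem_ofPred_eq, prunedLoss_eq_of_signature_eq hF h])
  have := h𝓗fin.to_subtype
  have h𝓗m : ∀ A : 𝓗, MeasurableSet (A : Set (Dataset 𝒳 n c)) := by
    rintro ⟨_, x, rfl⟩
    exact measurableSet_lt (hm 0 0) (hm _ _)
  set P := Measure.pi fun _ : Fin N => μ
  set A : Set (Fin N → Dataset 𝒳 n c) :=
    {s | ∃ i : 𝓗, ENNReal.ofReal ε < μ i ∧ ∀ k, s k ∉ (i : Set (Dataset 𝒳 n c))} with hA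
  have hsub : {Ds : Fin N → Dataset 𝒳 n c |
      ¬ ∀ c₁ c₂ : ℝ, IsERM a grow Ds c₁ c₂ → IsEpsOptimal a grow μ ε c₁ c₂} ⊆ A := by
    intro Ds hDs
    simp only [Set.mem_ofPred_eq, not_forall] at hDs
    obtain ⟨c₁, c₂, herm, hopt⟩ := hDs
    refine ⟨⟨worseSet a grow (c₁, c₂), ⟨(c₁, c₂), herm.1, herm.2.1⟩, rfl⟩, ?_,
      herm.notMem_worseSet⟩
    exact not_le.1 fun h => hopt (isEpsOptimal_of_measure_worseSet_le hm hε.le h)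
  refine (measure_mono hsub).trans ?_
  rcases le_or_gt 1 δ with hδ1 | hδ1
  · exact prob_le_one.trans (by simpa using hδ1)
  rcases le_or_gt 1 ε with hε1 | hε1
  · have : A = ∅ := by
      refine Set.eq_empty_of_forall_notMem fun s ⟨i, hi, _⟩ => ?_
      exact (prob_le_one.trans (ENNReal.one_le_ofReal.2 hε1)).not_gt hi
    simp [this]
  -- For `t = 1` the sample size has no `log t` to absorb the polynomial growth as `δ` approaches
  -- `1`, so the chain bound replaces double sampling.
  rcases ht.eq_or_lt with rfl | ht2
  · refine (measure_exists_missed_le_of_chain μ (fun i : 𝓗 => (i : Set (Dataset 𝒳 n c))) h𝓗m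
      ?_ N _).trans ?_
    · rintro ⟨_, x, rfl⟩ ⟨_, y, rfl⟩
      exact worseSet_chain a grow hsize x y
    · rw [← ENNReal.ofReal_one, ← ENNReal.ofReal_sub _ hε.le,
        ← ENNReal.ofReal_pow (by linarith)]
      refine ENNReal.ofReal_le_ofReal (one_sub_pow_le_of_sampleSize hε hε1 hδ ?_)
      simpa using hN
  · have hG : ∀ z : Fin N → Dataset 𝒳 n c × Dataset 𝒳 n c,
        (Set.range fun i : 𝓗 => pairPattern (i : Set (Dataset 𝒳 n c)) z).ncard ≤
          (2 * N * t + 1) ^ 3 := by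
      intro z
      have hr : (Set.range fun i : 𝓗 => pairPattern (i : Set (Dataset 𝒳 n c)) z) =
          Set.range fun x : Params => pairPattern (worseSet a grow x) z := by
        ext p
        simp [h𝓗]
      rw [hr]
      exact ncard_range_pairPattern_worseSet_le a grow hsize z
    have h1 := measure_exists_missed_mul_le μ (fun i : 𝓗 => (i : Set (Dataset 𝒳 n c))) h𝓗m hG
      (ENNReal.ofReal ε)
    have h2 := growth_le_of_sampleSize hε hε1 hδ hδ1 ht2 hN
    have h3 : (1 + ENNReal.ofReal ε) ^ N = ENNReal.ofReal ((1 + ε) ^ N) := by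
      rw [ENNReal.ofReal_pow (by positivity), ENNReal.ofReal_add zero_le_one hε.le,
        ENNReal.ofReal_one]
    have h4 : (((2 * N * t + 1) ^ 3 : ℕ) : ENNReal) ≤
        ENNReal.ofReal δ * ENNReal.ofReal ((1 + ε) ^ N) := by
      rw [← ENNReal.ofReal_mul hδ.le, ← ENNReal.ofReal_natCast]
      refine ENNReal.ofReal_le_ofReal ?_
      push_cast
      exact h2
    rw [h3] at h1
    have hpos : 0 < (1 + ε) ^ N := by positivity
    exact (ENNReal.mul_le_mul_iff_left (by simpa using hpos) ENNReal.ofReal_ne_top).1 (h1.trans h4)
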